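/- Let $X=\mathbb R^L_+$ be the consumption set, with the Euclidean norm, and let $\succeq$ be a preference relation (a complete and transitive binary relation) on $X$, with strict part $\succ$ and indifference $\sim$; write $R_+(x)=\{y\in X: y\succeq x\}$ and $\delta(x,A)=\inf_{y\in A}\|x-y\|$. Suppose that $\succeq$ is - continuous: $\{y\in X:y\succeq x\}$ and $\{y\in X:x\succeq y\}$ are closed for every $x\in X$; - monotone: $x\ge y$ and $x\neq y$ imply $x\succ y$; - strictly convex: $x\succeq y$ and $x\ne y$ imply $\lambda x+(1-\lambda)y\succ y$ for all $\lambda\in(0,1)$; - Lipschitzian: for every $r>0$ there are $H>0$ and $\eta>0$ such that, for all $x,y,z\in X$ with all coordinates in $[\frac1{1+r},1+r]$, if $x\sim y$ and $\|x-z\|<\eta$, then $\delta(x,R_+(z))\le H\,\delta(y,R_+(z))$. For $p\in\mathbb R^L_{++}$ let $B(p)=\{x\in X:p\cdot x\le 1\}$, and let $f(p)$ be the (unique) demand at $p$, so that $\{f(p)\}=\{x\in B(p):x\succeq y\text{ for all }y\in B(p)\}$. Let $p_1,p_2,\dots$ be a sequence in $\mathbb R^L_{++}$ that is dense in $\mathbb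 R^L_{++}$, and let $x_k=f(p_k)$ be the observed choices. For $x,y\in X$ write $x\succ^{R_n}y$ if there are $k\ge 1$ and indices $i_1,\dots,i_{k+1}\in\{1,\dots,n\}$ such that $x\ge x_{i_1}$, $p_{i_j}\cdot x_{i_{j+1}}<p_{i_j}\cdot x_{i_j}$ for $j=1,\dots,k$, and $x_{i_{k+1}}\ge y$. Define the revealed demand correspondence $$x^{R_n}(p)=\{x\in X: p\cdot x=1\text{ and there is no }x'\in X\text{ with }p\cdot x'\le 1\text{ and }x'\succ^{R_n}x\}.$$ Then for every $p\in\mathbb R^L_{++}$ and every $\varepsilon>0$ there is an $N$ such that, for all $n\ge N$, $$x^{R_n}(p)\subset\{x\in B(p):\|f(p)-x\|\le\varepsilon\}.$$ -/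

import Mathlib

namespace RevealedDemand

/-- Commodity space with `L` commodities; it carries the Euclidean norm and inner product. -/
abbrev Bundle (L : ℕ) : Type := EuclideanSpace ℝ (Fin L)

/-- The consumption set, the nonnegative orthant. -/
def consumptionSet (L : ℕ) : Set (Bundle L) := {x | ∀ l, 0 ≤ x l}

/-- Strictly positive price vectors. -/
def positivePrices (L : ℕ) : Set (Bundle L) := {p | ∀ l, 0 < p l}

section Preferences

variable {L : ℕ}

/-- `R x y` reads "`x` is at least as good as `y`". Only its values on the consumption set matter:
there it is complete (hence reflexive) and transitive. -/
structure IsPreference (R : Bundle L → Bundle L → Prop) : Prop where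
  complete : ∀ x ∈ consumptionSet L, ∀ y ∈ consumptionSet L, R x y ∨ R y x
  transitive : ∀ x ∈ consumptionSet L, ∀ y ∈ consumptionSet L, ∀ z ∈ consumptionSet L,
    R x y → R y z → R x z

/-- Strict preference. -/
def Strict (R : Bundle L → Bundle L → Prop) (x y : Bundle L) : Prop := R x y ∧ ¬ R y x

/-- Indifference. -/
def Indifferent (R : Bundle L → Bundle L → Prop) (x y : Bundle L) : Prop := R x y ∧ R y x

def upperContour (R : Bundle L → Bundle L → Prop) (x : Bundle L) : Set (Bundle L) :=
  {y | y ∈ consumptionSet L ∧ R y x}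

def lowerContour (R : Bundle L → Bundle L → Prop) (x : Bundle L) : Set (Bundle L) :=
  {y | y ∈ consumptionSet L ∧ R x y}

/-- Continuity: upper and lower contour sets are closed (the consumption set is itself closed, so
closed in it and closed in the whole space are the same). -/
def IsContinuousPref (R : Bundle L → Bundle L → Prop) : Prop :=
  ∀ x ∈ consumptionSet L, IsClosed (upperContour R x) ∧ IsClosed (lowerContour R x)

/-- Monotonicity: `x ≥ y` in every coordinate and `x ≠ y` imply that `x` is strictly preferred. -/
def IsMonotonePref (R : Bundle L → Bundle L → Prop) : Prop :=
  ∀ x ∈ consumptionSet L, ∀ y ∈ consumptionSet L, (∀ l, y l ≤ x l) → x ≠ y → Strict R x y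

def IsStrictlyConvexPref (R : Bundle L → Bundle L → Prop) : Prop :=
  ∀ x ∈ consumptionSet L, ∀ y ∈ consumptionSet L, R x y → x ≠ y →
    ∀ t : ℝ, 0 < t → t < 1 → Strict R (t • x + (1 - t) • y) y

/-- The box of bundles all of whose coordinates lie between `1 / (1 + r)` and `1 + r`. -/
def interiorBox (L : ℕ) (r : ℝ) : Set (Bundle L) :=
  {w | w ∈ consumptionSet L ∧ ∀ l, 1 / (1 + r) ≤ w l ∧ w l ≤ 1 + r}

/-- Lipschitzian preferences. The upper contour set of `z` contains `z` when the relation is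
reflexive, so the `Metric.infDist` below is the infimum of distances to a nonempty set. -/
def IsLipschitzianPref (R : Bundle L → Bundle L → Prop) : Prop :=
  ∀ r : ℝ, 0 < r → ∃ H : ℝ, 0 < H ∧ ∃ ε : ℝ, 0 < ε ∧
    ∀ x ∈ interiorBox L r, ∀ y ∈ interiorBox L r, ∀ z ∈ interiorBox L r,
      Indifferent R x y → ‖x - z‖ < ε →
        Metric.infDist x (upperContour R z) ≤ H * Metric.infDist y (upperContour R z)

/-- Budget set at price `p`, with income normalized to one. -/
def budget (p : Bundle L) : Set (Bundle L) := {x | x ∈ consumptionSet L ∧ inner ℝ p x ≤ 1}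

/-- The Walrasian demand correspondence. -/
def demand (R : Bundle L → Bundle L → Prop) (p : Bundle L) : Set (Bundle L) :=
  {x | x ∈ budget p ∧ ∀ y ∈ budget p, R x y}

/-- `a` is strictly revealed preferred to `b` through the first `n` observations (those with index
`< n`) of the prices `p` and choices `x`: there is a finite sequence of observations
`i 0, …, i k`, with at least one strict comparison (`1 ≤ k`), such that `a ≥ x (i 0)`, the bundle
`x (i (j + 1))` costs strictly less than `x (i j)` at the prices `p (i j)`, and `x (i k) ≥ b`. -/
def RevealedPreferred (p x : ℕ → Bundle L) (n : ℕ) (a b : Bundle L) : Prop :=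
  ∃ (k : ℕ) (i : ℕ → ℕ), 1 ≤ k ∧ (∀ j ≤ k, i j < n) ∧
    (∀ l, x (i 0) l ≤ a l) ∧
    (∀ j < k, inner ℝ (p (i j)) (x (i (j + 1))) < inner ℝ (p (i j)) (x (i j))) ∧
    (∀ l, b l ≤ x (i k) l)

/-- The revealed demand correspondence after `n` observations, at the price `q`. -/
def revealedDemand (p x : ℕ → Bundle L) (n : ℕ) (q : Bundle L) : Set (Bundle L) :=
  {y | y ∈ consumptionSet L ∧ inner ℝ q y = 1 ∧
    ¬ ∃ y' ∈ consumptionSet L, inner ℝ q y' ≤ 1 ∧ RevealedPreferred p x n y' y}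

end Preferences

end RevealedDemand

namespace RevealedDemand

open Filter Topology

/-! The core is `exists_revealedPreferred`: if `U b < U a` for positive bundles `a`, `b`, finitely
many observations reveal it. Then any affordable bundle other than `f q`, along with a neighbourhood
of it, is eventually revealed worse than an affordable bundle, and compactness of the affordable
bundles at distance at least `ε` from `f q` gives a single `N`.

For the core, suppose `a` is never revealed preferred to `b`. Let `P` be the set of positive prices
`q` such that whatever costs less than 1 at `q` also costs less than 1 at an observed price
reachable from `a` by a chain of strict comparisons. Density of the prices and continuity of demand
give three facts: `P` contains the prices supporting `τ • a` for `τ < 1`; it contains every price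
supporting a bundle that costs less than 1 at some member of `P`; and `b` costs at least 1
throughout `P`.

`utility_le_of_price_closure` turns these into `U a ≤ U b`. The function `φ w = inf {p · w : p ∈ P}`
is concave, and a price `π` supporting `w / φ w` is, up to an arbitrarily small error, in `P` and a
supergradient of `φ` at `w`. Take `n` equal steps `m j` from `a` to `b`. At the price for `m (j +
1)`, the bundle `m j / d` with `d = π · m j` is just affordable, hence no better than `m (j + 1) / φ
(m (j + 1))`, and `d` differs from `φ (m j)` only by a concavity defect. The Lipschitz property
makes the utility drop linear in that defect, so the drops can be summed; the defects telescope to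
`O(1 / n)`. Since `φ a ≤ 1 ≤ φ b`, letting `n` grow yields `U a ≤ U b`. -/

/-- The bundle with one unit of every commodity. -/
def ones (L : ℕ) : Bundle L := WithLp.toLp 2 fun _ => 1

@[simp] lemma ones_apply {L : ℕ} (l : Fin L) : ones L l = 1 := rfl

/-! ### Coordinates, costs and the nonnegative orthant. -/

lemma inner_eq_sum {L : ℕ} (p x : Bundle L) : inner ℝ p x = ∑ l, p l * x l := by
  simp [PiLp.inner_apply, mul_comm]

lemma abs_apply_le_norm {L : ℕ} (x : Bundle L) (l : Fin L) : |x l| ≤ ‖x‖ := by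
  simpa using PiLp.norm_apply_le x l

lemma norm_le_sum_abs {L : ℕ} (x : Bundle L) : ‖x‖ ≤ ∑ l, |x l| := by
  rw [EuclideanSpace.norm_eq]
  exact Real.sqrt_le_iff.2 ⟨by positivity,
    Finset.sum_sq_le_sq_sum_of_nonneg fun l _ => norm_nonneg _⟩

lemma continuous_apply {L : ℕ} (l : Fin L) : Continuous fun x : Bundle L => x l := by
  fun_prop

lemma isClosed_consumptionSet (L : ℕ) : IsClosed (consumptionSet L) := by
  simp only [consumptionSet, Set.ofPred_forall]
  exact isClosed_iInter fun l => isClosed_le continuous_const (continuous_apply l)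

lemma isOpen_positivePrices (L : ℕ) : IsOpen (positivePrices L) := by
  simp only [positivePrices, Set.ofPred_forall]
  exact isOpen_iInter_of_finite fun l => isOpen_lt continuous_const (continuous_apply l)

lemma positivePrices_subset_consumptionSet (L : ℕ) : positivePrices L ⊆ consumptionSet L :=
  fun _ hx l => (hx l).le

lemma smul_ones_mem {L : ℕ} {c : ℝ} (hc : 0 ≤ c) : c • ones L ∈ consumptionSet L := fun l => by
  simpa using hc

lemma convex_consumptionSet (L : ℕ) : Convex ℝ (consumptionSet L) := by
  intro x hx y hy s t hs ht _ l
  have h1 := mul_nonneg hs (hx l)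
  have h2 := mul_nonneg ht (hy l)
  simpa using add_nonneg h1 h2

lemma inner_le_inner {L : ℕ} {p x y : Bundle L} (hp : p ∈ consumptionSet L)
    (h : ∀ l, x l ≤ y l) : inner ℝ p x ≤ inner ℝ p y := by
  rw [inner_eq_sum, inner_eq_sum]
  exact Finset.sum_le_sum fun l _ => mul_le_mul_of_nonneg_left (h l) (hp l)

lemma inner_lt_inner {L : ℕ} [NeZero L] {p x y : Bundle L} (hp : p ∈ positivePrices L)
    (h : ∀ l, x l < y l) : inner ℝ p x < inner ℝ p y := by
  rw [inner_eq_sum, inner_eq_sum]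
  exact Finset.sum_lt_sum_of_nonempty Finset.univ_nonempty
    fun l _ => mul_lt_mul_of_pos_left (h l) (hp l)

lemma inner_pos {L : ℕ} [NeZero L] {p x : Bundle L} (hp : p ∈ positivePrices L)
    (hx : x ∈ positivePrices L) : 0 < inner ℝ p x := by
  simpa using inner_lt_inner (x := 0) hp fun l => by simpa using hx l

lemma inner_nonneg {L : ℕ} {p x : Bundle L} (hp : p ∈ consumptionSet L)
    (hx : x ∈ consumptionSet L) : 0 ≤ inner ℝ p x := by
  rw [inner_eq_sum]
  exact Finset.sum_nonneg fun l _ => mul_nonneg (hp l) (hx l)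

/-- A continuous, strictly monotone, strictly quasiconcave utility function on the consumption set
that measures a bundle by the equivalent number of units of `ones L` and is Lipschitz on every
`interiorBox`. -/
structure IsRegularUtility {L : ℕ} (U : Bundle L → ℝ) : Prop where
  continuousOn : ContinuousOn U (consumptionSet L)
  lt_of_le_of_ne : ∀ x ∈ consumptionSet L, ∀ y ∈ consumptionSet L, (∀ l, y l ≤ x l) → x ≠ y →
    U y < U x
  quasiconcave : ∀ x ∈ consumptionSet L, ∀ y ∈ consumptionSet L, U y ≤ U x → x ≠ y →
    ∀ t : ℝ, 0 < t → t < 1 → U y < U (t • x + (1 - t) • y)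
  lipschitz : ∀ r : ℝ, 0 < r → ∃ K : ℝ, 0 < K ∧ ∀ x ∈ interiorBox L r, ∀ y ∈ interiorBox L r,
    |U x - U y| ≤ K * ‖x - y‖

/-- `U` represents the preference relation `R` on the consumption set. -/
def Represents {L : ℕ} (U : Bundle L → ℝ) (R : Bundle L → Bundle L → Prop) : Prop :=
  ∀ x ∈ consumptionSet L, ∀ y ∈ consumptionSet L, R x y ↔ U y ≤ U x

/-! ### A Lipschitz utility function representing the preference. -/

section Utility

variable {L : ℕ} {R : Bundle L → Bundle L → Prop}

/-- The number of units of `ones L` equivalent to `x`. -/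
noncomputable def diagonalUtility (R : Bundle L → Bundle L → Prop) (x : Bundle L) : ℝ :=
  sSup {c | 0 ≤ c ∧ R x (c • ones L)}

lemma rel_of_le (hpref : IsPreference R) (hmono : IsMonotonePref R) {x y : Bundle L}
    (hx : x ∈ consumptionSet L) (hy : y ∈ consumptionSet L) (h : ∀ l, y l ≤ x l) : R x y := by
  by_cases hxy : x = y
  · subst hxy
    simpa using hpref.complete x hx x hx
  · exact (hmono x hx y hy h hxy).1

lemma rel_smul_ones_iff [NeZero L] (hpref : IsPreference R) (hmono : IsMonotonePref R) {c d : ℝ}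
    (hc : 0 ≤ c) (hd : 0 ≤ d) : R (c • ones L) (d • ones L) ↔ d ≤ c := by
  constructor
  · intro h
    by_contra! hlt
    refine (hmono (d • ones L) (smul_ones_mem hd) (c • ones L) (smul_ones_mem hc) (fun l => ?_)
      fun he => ?_).2 h
    · simpa using hlt.le
    · have := congrArg (fun x : Bundle L => x (0 : Fin L)) he
      simp at this
      linarith
  · intro h
    exact rel_of_le hpref hmono (smul_ones_mem hc) (smul_ones_mem hd) fun l => by simpa using h

lemma isClosed_setOf_rel_smul_ones (hcont : IsContinuousPref R) {x : Bundle L}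
    (hx : x ∈ consumptionSet L) :
    IsClosed {c : ℝ | 0 ≤ c ∧ R x (c • ones L)} ∧ IsClosed {c : ℝ | 0 ≤ c ∧ R (c • ones L) x} := by
  have hc : Continuous fun c : ℝ => c • ones L := by fun_prop
  have h0 : IsClosed {c : ℝ | 0 ≤ c} := isClosed_Ici
  constructor
  · convert h0.inter ((hcont x hx).2.preimage hc) using 1
    ext c
    simp only [Set.mem_ofPred_eq, lowerContour, Set.mem_inter_iff, Set.mem_preimage]
    exact ⟨fun h => ⟨h.1, smul_ones_mem h.1, h.2⟩, fun h => ⟨h.1, h.2.2⟩⟩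
  · convert h0.inter ((hcont x hx).1.preimage hc) using 1
    ext c
    simp only [Set.mem_ofPred_eq, upperContour, Set.mem_inter_iff, Set.mem_preimage]
    exact ⟨fun h => ⟨h.1, smul_ones_mem h.1, h.2⟩, fun h => ⟨h.1, h.2.2⟩⟩

/-- Closedness of the lower contour set puts the supremum in its defining set; every larger multiple
of `ones L` is at least as good as `x`, and closedness of the upper contour set carries this down to
the supremum. -/
lemma diagonalUtility_spec [NeZero L] (hpref : IsPreference R) (hcont : IsContinuousPref R)
    (hmono : IsMonotonePref R) {x : Bundle L} (hx : x ∈ consumptionSet L) :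
    0 ≤ diagonalUtility R x ∧ Indifferent R x (diagonalUtility R x • ones L) := by
  set S := {c : ℝ | 0 ≤ c ∧ R x (c • ones L)} with hS
  obtain ⟨hcl, hcl'⟩ := isClosed_setOf_rel_smul_ones hcont hx
  have hne : S.Nonempty := ⟨0, le_rfl, rel_of_le hpref hmono hx (smul_ones_mem le_rfl)
    fun l => by simpa using hx l⟩
  have hbd : BddAbove S := by
    refine ⟨‖x‖, fun c hc => ?_⟩
    have h1 : R (‖x‖ • ones L) x := rel_of_le hpref hmono (smul_ones_mem (norm_nonneg x)) hx
      fun l => by simpa using (le_abs_self _).trans (abs_apply_le_norm x l)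
    exact (rel_smul_ones_iff hpref hmono (norm_nonneg x) hc.1).1
      (hpref.transitive _ (smul_ones_mem (norm_nonneg x)) _ hx _ (smul_ones_mem hc.1) h1 hc.2)
  have hmem : diagonalUtility R x ∈ S := hcl.csSup_mem hne hbd
  refine ⟨hmem.1, hmem.2, ?_⟩
  have hgt : ∀ c, diagonalUtility R x < c → c ∈ {c : ℝ | 0 ≤ c ∧ R (c • ones L) x} := by
    intro c hc
    have hc0 : 0 ≤ c := hmem.1.trans hc.le
    refine ⟨hc0, (hpref.complete _ (smul_ones_mem hc0) x hx).resolve_right fun h => ?_⟩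
    exact absurd (le_csSup hbd (show c ∈ S from ⟨hc0, h⟩)) (not_le.2 hc)
  have : diagonalUtility R x ∈ closure (Set.Ioi (diagonalUtility R x)) := by simp
  exact (hcl'.closure_subset_iff.2 hgt this).2

lemma represents_diagonalUtility [NeZero L] (hpref : IsPreference R) (hcont : IsContinuousPref R)
    (hmono : IsMonotonePref R) : Represents (diagonalUtility R) R := by
  intro x hx y hy
  obtain ⟨hx0, hx1, hx2⟩ := diagonalUtility_spec hpref hcont hmono hx
  obtain ⟨hy0, hy1, hy2⟩ := diagonalUtility_spec hpref hcont hmono hy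
  have hX := smul_ones_mem (L := L) hx0
  have hY := smul_ones_mem (L := L) hy0
  rw [← rel_smul_ones_iff hpref hmono hx0 hy0]
  exact ⟨fun h => hpref.transitive _ hX _ hx _ hY hx2 (hpref.transitive _ hx _ hy _ hY h hy1),
    fun h => hpref.transitive _ hx _ hX _ hy hx1 (hpref.transitive _ hX _ hY _ hy h hy2)⟩

lemma diagonalUtility_smul_ones [NeZero L] (hpref : IsPreference R) (hcont : IsContinuousPref R)
    (hmono : IsMonotonePref R) {c : ℝ} (hc : 0 ≤ c) : diagonalUtility R (c • ones L) = c := by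
  obtain ⟨h0, h1, h2⟩ := diagonalUtility_spec hpref hcont hmono (smul_ones_mem (L := L) hc)
  exact le_antisymm ((rel_smul_ones_iff hpref hmono hc h0).1 h1)
    ((rel_smul_ones_iff hpref hmono h0 hc).1 h2)

lemma Represents.strict_iff {U : Bundle L → ℝ} (hU : Represents U R) {x y : Bundle L}
    (hx : x ∈ consumptionSet L) (hy : y ∈ consumptionSet L) : Strict R x y ↔ U y < U x := by
  rw [Strict, hU x hx y hy, hU y hy x hx, not_le]
  exact ⟨fun h => h.2, fun h => ⟨h.le, h⟩⟩

/-- Preimages of open rays are complements of contour sets of bundles `c • ones L`; negative `c` is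
trivial because the utility is nonnegative. -/
lemma continuousOn_diagonalUtility [NeZero L] (hpref : IsPreference R)
    (hcont : IsContinuousPref R) (hmono : IsMonotonePref R) :
    ContinuousOn (diagonalUtility R) (consumptionSet L) := by
  have hrep := represents_diagonalUtility hpref hcont hmono
  have h0 : ∀ x ∈ consumptionSet L, 0 ≤ diagonalUtility R x :=
    fun x hx => (diagonalUtility_spec hpref hcont hmono hx).1
  rw [continuousOn_iff_continuous_domRestrict, OrderTopology.continuous_iff]
  intro c
  rcases lt_or_ge c 0 with hc | hc
  · constructor
    · convert isOpen_univ using 1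
      ext ⟨x, hx⟩
      simpa using hc.trans_le (h0 x hx)
    · convert isOpen_empty using 1
      ext ⟨x, hx⟩
      simpa using hc.le.trans (h0 x hx)
  · have hcm := smul_ones_mem (L := L) hc
    have hcv := diagonalUtility_smul_ones hpref hcont hmono hc
    constructor
    · have := ((hcont _ hcm).2.preimage (continuous_subtype_val (p := (· ∈ consumptionSet L))))
      convert this.isOpen_compl using 1
      ext ⟨x, hx⟩
      have := hrep _ hcm x hx
      simp [lowerContour, this, hcv]
    · have := ((hcont _ hcm).1.preimage (continuous_subtype_val (p := (· ∈ consumptionSet L))))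
      convert this.isOpen_compl using 1
      ext ⟨x, hx⟩
      have := hrep x hx _ hcm
      simp [upperContour, this, hcv]

lemma isCompact_interiorBox (L : ℕ) (r : ℝ) : IsCompact (interiorBox L r) := by
  have hcl : IsClosed (interiorBox L r) := by
    have : interiorBox L r = consumptionSet L ∩ ⋂ l, {w | 1 / (1 + r) ≤ w l ∧ w l ≤ 1 + r} := by
      ext; simp [interiorBox]
    rw [this]
    refine (isClosed_consumptionSet L).inter (isClosed_iInter fun l => ?_)
    exact (isClosed_le continuous_const (continuous_apply l)).inter
      (isClosed_le (continuous_apply l) continuous_const)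
  refine Metric.isCompact_of_isClosed_isBounded hcl ?_
  refine (Metric.isBounded_iff_subset_closedBall 0).2 ⟨∑ _l : Fin L, (1 + r), fun x hx => ?_⟩
  rw [mem_closedBall_zero_iff]
  refine (norm_le_sum_abs x).trans (Finset.sum_le_sum fun l _ => ?_)
  rw [abs_of_nonneg (hx.1 l)]
  exact (hx.2 l).2

/-- The Lipschitz condition is applied to `x`, its diagonal equivalent and the diagonal equivalent
of `y`: distance from the diagonal point to the upper contour set bounds the utility gap from above,
while distance from `x` is at most `‖x - y‖`. -/
lemma diagonalUtility_lipschitz [NeZero L] (hpref : IsPreference R) (hcont : IsContinuousPref R)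
    (hmono : IsMonotonePref R) (hlip : IsLipschitzianPref R) {r : ℝ} (hr : 0 < r) :
    ∃ K : ℝ, 0 < K ∧ ∀ x ∈ interiorBox L r, ∀ y ∈ interiorBox L r,
      |diagonalUtility R x - diagonalUtility R y| ≤ K * ‖x - y‖ := by
  set U := diagonalUtility R with hU
  have hrep := represents_diagonalUtility hpref hcont hmono
  obtain ⟨H, hH, η, hη, hl⟩ := hlip r hr
  have hdiag : ∀ x ∈ interiorBox L r, 1 / (1 + r) ≤ U x ∧ U x ≤ 1 + r := by
    intro x hx
    have hlo : 0 ≤ 1 / (1 + r) := by positivity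
    have hhi : 0 ≤ 1 + r := by positivity
    constructor
    · rw [← diagonalUtility_smul_ones hpref hcont hmono hlo,
        ← hrep _ hx.1 _ (smul_ones_mem hlo)]
      exact rel_of_le hpref hmono hx.1 (smul_ones_mem hlo) fun l => by simpa using (hx.2 l).1
    · rw [← diagonalUtility_smul_ones hpref hcont hmono hhi,
        ← hrep _ (smul_ones_mem hhi) _ hx.1]
      exact rel_of_le hpref hmono (smul_ones_mem hhi) hx.1 fun l => by simpa using (hx.2 l).2
  have hnn : ∀ x ∈ consumptionSet L, 0 ≤ U x :=
    fun x hx => (diagonalUtility_spec hpref hcont hmono hx).1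
  have hbox : ∀ x ∈ interiorBox L r, U x • ones L ∈ interiorBox L r := fun x hx =>
    ⟨smul_ones_mem (hnn x hx.1), fun l => by simpa using hdiag x hx⟩
  have hlocal : ∀ x ∈ interiorBox L r, ∀ y ∈ interiorBox L r, U x ≤ U y →
      (U y - U x) * ‖ones L‖ < η → U y - U x ≤ H * ‖x - y‖ := by
    intro x hx y hy hxy hsmall
    have hyX := smul_ones_mem (L := L) (hnn y hy.1)
    have h1 := hl _ (hbox x hx) x hx _ (hbox y hy)
      (by
        obtain ⟨_, h1, h2⟩ := diagonalUtility_spec hpref hcont hmono hx.1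
        exact ⟨h2, h1⟩)
      (by
        rw [← sub_smul, norm_smul, Real.norm_eq_abs, abs_sub_comm, abs_of_nonneg (by linarith)]
        exact hsmall)
    have hyin : y ∈ upperContour R (U y • ones L) :=
      ⟨hy.1, (diagonalUtility_spec hpref hcont hmono hy.1).2.1⟩
    have h2 : Metric.infDist x (upperContour R (U y • ones L)) ≤ ‖x - y‖ := by
      rw [← dist_eq_norm]
      exact Metric.infDist_le_dist_of_mem hyin
    have h3 : U y - U x ≤ Metric.infDist (U x • ones L) (upperContour R (U y • ones L)) := by
      refine (Metric.le_infDist ⟨y, hyin⟩).2 fun w hw => ?_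
      -- Otherwise `w` would be strictly dominated by `U y • ones L`.
      have : ∃ l, U y ≤ w l := by
        by_contra! hcon
        refine (hmono _ hyX w hw.1 (fun l => by simpa using (hcon l).le) fun he => ?_).2 hw.2
        have := hcon 0
        rw [← he] at this
        simp at this
      obtain ⟨l, hlw⟩ := this
      rw [dist_comm, dist_eq_norm]
      refine le_trans ?_ ((le_abs_self _).trans (abs_apply_le_norm _ l))
      simpa using hlw
    calc U y - U x ≤ _ := h3
      _ ≤ _ := h1
      _ ≤ _ := mul_le_mul_of_nonneg_left h2 hH.le
  have huc : UniformContinuousOn U (interiorBox L r) :=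
    (isCompact_interiorBox L r).uniformContinuousOn_of_continuous
      ((continuousOn_diagonalUtility hpref hcont hmono).mono fun x hx => hx.1)
  -- Below distance `δ` the diagonal equivalents are within `η`, so `hlocal` applies; beyond it, the
  -- bound `1 + r` on the utility suffices.
  obtain ⟨δ, hδ, hδU⟩ := Metric.uniformContinuousOn_iff.1 huc (η / (‖ones L‖ + 1)) (by positivity)
  refine ⟨H + (1 + r) / δ, by positivity, ?_⟩
  have hone : ∀ x ∈ interiorBox L r, ∀ y ∈ interiorBox L r, U x ≤ U y →
      U y - U x ≤ (H + (1 + r) / δ) * ‖x - y‖ := by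
    intro x hx y hy hxy
    have hn := norm_nonneg (x - y)
    rw [add_mul]
    rcases lt_or_ge ‖x - y‖ δ with h | h
    · have h1 := hδU x hx y hy (by rwa [dist_eq_norm])
      rw [Real.dist_eq, abs_sub_comm, abs_of_nonneg (by linarith), lt_div_iff₀ (by positivity)]
        at h1
      have h2 := hlocal x hx y hy hxy (by linarith)
      have : 0 ≤ (1 + r) / δ * ‖x - y‖ := by positivity
      linarith
    · have h1 : (1 + r) / δ * δ ≤ (1 + r) / δ * ‖x - y‖ :=
        mul_le_mul_of_nonneg_left h (by positivity)
      rw [div_mul_cancel₀ _ hδ.ne'] at h1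
      have h2 := (hdiag y hy).2
      have h3 := hnn x hx.1
      have : 0 ≤ H * ‖x - y‖ := by positivity
      linarith
  intro x hx y hy
  rcases le_total (U x) (U y) with h | h
  · rw [abs_sub_comm, abs_of_nonneg (by linarith)]
    exact hone x hx y hy h
  · rw [abs_of_nonneg (by linarith), norm_sub_rev]
    exact hone y hy x hx h

theorem exists_isRegularUtility [NeZero L] (hpref : IsPreference R) (hcont : IsContinuousPref R)
    (hconv : IsStrictlyConvexPref R) (hmono : IsMonotonePref R) (hlip : IsLipschitzianPref R) :
    ∃ U : Bundle L → ℝ, IsRegularUtility U ∧ Represents U R := by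
  have hrep := represents_diagonalUtility hpref hcont hmono
  refine ⟨diagonalUtility R, ⟨continuousOn_diagonalUtility hpref hcont hmono, ?_, ?_,
    fun r hr => diagonalUtility_lipschitz hpref hcont hmono hlip hr⟩, hrep⟩
  · intro x hx y hy h hne
    exact (hrep.strict_iff hx hy).1 (hmono x hx y hy h hne)
  · intro x hx y hy h hne t ht0 ht1
    exact (hrep.strict_iff (convex_consumptionSet L hx hy ht0.le (by linarith) (by ring)) hy).1
      (hconv x hx y hy ((hrep x hx y hy).2 h) hne t ht0 ht1)

end Utility

/-! ### Existence, uniqueness and continuity of demand; supporting prices. -/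

section Demand

variable {L : ℕ} {U : Bundle L → ℝ} {p x : Bundle L}

/-- `x` maximizes `U` on the budget set at `p`. -/
structure IsDemanded (U : Bundle L → ℝ) (p x : Bundle L) : Prop where
  mem : x ∈ budget p
  le : ∀ y ∈ budget p, U y ≤ U x

lemma mem_demand_iff {R : Bundle L → Bundle L → Prop} (hrep : Represents U R) :
    x ∈ demand R p ↔ IsDemanded U p x := by
  constructor
  · exact fun h => ⟨h.1, fun y hy => (hrep x h.1.1 y hy.1).1 (h.2 y hy)⟩
  · exact fun h => ⟨h.mem, fun y hy => (hrep x h.mem.1 y hy.1).2 (h.le y hy)⟩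

lemma ones_mem (L : ℕ) : ones L ∈ positivePrices L := fun l => by simp

lemma isClosed_budget (p : Bundle L) : IsClosed (budget p) := by
  have : IsClosed {x : Bundle L | inner ℝ p x ≤ 1} :=
    isClosed_le (by fun_prop) continuous_const
  exact (isClosed_consumptionSet L).inter this

lemma isCompact_budget (hp : p ∈ positivePrices L) : IsCompact (budget p) := by
  refine Metric.isCompact_of_isClosed_isBounded (isClosed_budget p) ?_
  refine (Metric.isBounded_iff_subset_closedBall 0).2 ⟨∑ l, 1 / p l, fun x hx => ?_⟩
  rw [mem_closedBall_zero_iff]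
  refine (norm_le_sum_abs x).trans (Finset.sum_le_sum fun l _ => ?_)
  rw [abs_of_nonneg (hx.1 l), le_div_iff₀ (hp l), mul_comm]
  refine le_trans ?_ hx.2
  rw [inner_eq_sum]
  exact Finset.single_le_sum (f := fun l => p l * x l)
    (fun l _ => mul_nonneg (hp l).le (hx.1 l)) (Finset.mem_univ l)

lemma exists_isDemanded (hU : IsRegularUtility U) (hp : p ∈ positivePrices L) :
    ∃ x, IsDemanded U p x := by
  obtain ⟨x, hx, hmax⟩ := (isCompact_budget hp).exists_isMaxOn
    ⟨0, fun l => by simp, by simp⟩ (hU.continuousOn.mono fun x hx => hx.1)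
  exact ⟨x, hx, fun y hy => hmax hy⟩

lemma IsDemanded.unique (hU : IsRegularUtility U) {y : Bundle L} (hx : IsDemanded U p x)
    (hy : IsDemanded U p y) : x = y := by
  by_contra hne
  have h1 := hU.quasiconcave x hx.mem.1 y hy.mem.1 (hx.le y hy.mem) hne (1 / 2) (by norm_num)
    (by norm_num)
  refine absurd (hy.le _ ⟨convex_consumptionSet L hx.mem.1 hy.mem.1 (by norm_num) (by norm_num)
    (by norm_num), ?_⟩) (not_le.2 h1)
  rw [inner_add_right, inner_smul_right, inner_smul_right]
  have h2 := hx.mem.2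
  have h3 := hy.mem.2
  linarith

lemma IsDemanded.inner_eq_one [NeZero L] (hU : IsRegularUtility U) (hp : p ∈ positivePrices L)
    (hx : IsDemanded U p x) : inner ℝ p x = 1 := by
  by_contra hne
  have hlt := lt_of_le_of_ne hx.mem.2 hne
  have hpos := inner_pos hp (ones_mem L)
  set δ := (1 - inner ℝ p x) / inner ℝ p (ones L) with hδ
  have hδ0 : 0 < δ := div_pos (by linarith) hpos
  have hmem : x + δ • ones L ∈ consumptionSet L := fun l => by
    simpa using add_nonneg (hx.mem.1 l) hδ0.le
  refine absurd (hx.le (x + δ • ones L) ⟨hmem, ?_⟩)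
    (not_le.2 (hU.lt_of_le_of_ne _ hmem x hx.mem.1 (fun l => by simpa using hδ0.le) fun he => ?_))
  · rw [inner_add_right, inner_smul_right, hδ, div_mul_cancel₀ _ hpos.ne']
    linarith
  · have := congrArg (fun x : Bundle L => x (0 : Fin L)) he
    simp at this
    linarith

lemma IsRegularUtility.monotone (hU : IsRegularUtility U) {y : Bundle L}
    (hx : x ∈ consumptionSet L) (hy : y ∈ consumptionSet L) (h : ∀ l, x l ≤ y l) : U x ≤ U y := by
  by_cases hne : y = x
  · rw [hne]
  · exact (hU.lt_of_le_of_ne y hy x hx h hne).le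

lemma convex_setOf_lt_utility (hU : IsRegularUtility U) (z : Bundle L) :
    Convex ℝ (positivePrices L ∩ {y | U z < U y}) := by
  have key : ∀ x ∈ positivePrices L, ∀ y ∈ positivePrices L, U z < U y → U y ≤ U x →
      ∀ s t : ℝ, 0 < s → 0 < t → s + t = 1 → U z < U (s • x + t • y) := by
    intro x hx y hy hzy hyx s t hs ht hst
    by_cases hne : x = y
    · rw [hne, ← add_smul, hst, one_smul]
      exact hzy
    · have := hU.quasiconcave x (positivePrices_subset_consumptionSet L hx) y
        (positivePrices_subset_consumptionSet L hy) hyx hne s hs (by linarith)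
      rw [show 1 - s = t by linarith] at this
      exact hzy.trans this
  refine convex_iff_forall_pos.2 fun x hx y hy s t hs ht hst => ⟨fun l => ?_, ?_⟩
  · have h1 := mul_pos hs (hx.1 l)
    have h2 := mul_pos ht (hy.1 l)
    simpa using add_pos h1 h2
  · rcases le_total (U y) (U x) with h | h
    · exact key x hx.1 y hy.1 hy.2 h s t hs ht hst
    · rw [Set.mem_ofPred_eq, add_comm]
      exact key y hy.1 x hx.1 hx.2 h t s ht hs (by linarith)

lemma isOpen_setOf_lt_utility (hU : IsRegularUtility U) (z : Bundle L) :
    IsOpen (positivePrices L ∩ {y | U z < U y}) :=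
  (hU.continuousOn.mono (positivePrices_subset_consumptionSet L)).isOpen_inter_preimage
    (isOpen_positivePrices L) isOpen_Ioi

/-- Every bundle with positive coordinates is demanded at some price. -/
lemma exists_supporting_price [NeZero L] (hU : IsRegularUtility U) {z : Bundle L}
    (hz : z ∈ positivePrices L) : ∃ p ∈ positivePrices L, IsDemanded U p z := by
  have hzX := positivePrices_subset_consumptionSet L hz
  obtain ⟨f, hf⟩ := geometric_hahn_banach_open_point (convex_setOf_lt_utility hU z)
    (isOpen_setOf_lt_utility hU z) (x := z) fun h => (lt_irrefl (U z)) h.2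
  set g : Bundle L := (InnerProductSpace.toDual ℝ (Bundle L)).symm (-f) with hg
  have hgf : ∀ y, inner ℝ g y = -f y := fun y => by
    simp [hg]
  have hsep : ∀ y ∈ positivePrices L, U z < U y → inner ℝ g z < inner ℝ g y := fun y hy hyz => by
    rw [hgf, hgf]
    exact neg_lt_neg (hf y ⟨hy, hyz⟩)
  -- More of any one commodity is strictly better, hence strictly dearer.
  have hgpos : g ∈ positivePrices L := by
    intro l
    have hpos : z + EuclideanSpace.single l (1 : ℝ) ∈ positivePrices L := fun k => by
      have := hz k
      by_cases h : k = l
      · subst h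
        simp
        linarith
      · simpa [h] using this
    have h1 := hsep _ hpos (hU.lt_of_le_of_ne _ (positivePrices_subset_consumptionSet L hpos) z hzX
      (fun k => by by_cases h : k = l <;> simp [h]) (by simp))
    rw [inner_add_right] at h1
    have h2 : inner ℝ g (EuclideanSpace.single l (1 : ℝ)) = g l := by
      rw [EuclideanSpace.inner_single_right]
      simp
    linarith
  have hc : 0 < inner ℝ g z := inner_pos hgpos hz
  have hin : ∀ y, inner ℝ ((inner ℝ g z)⁻¹ • g) y = (inner ℝ g z)⁻¹ * inner ℝ g y :=
    fun y => by rw [real_inner_smul_left]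
  refine ⟨(inner ℝ g z)⁻¹ • g, fun l => ?_, ⟨hzX, ?_⟩, fun y hy => ?_⟩
  · have := mul_pos (inv_pos.2 hc) (hgpos l)
    simpa using this
  · rw [hin, inv_mul_cancel₀ hc.ne']
  · by_contra! hlt
    have hyg : inner ℝ g y ≤ inner ℝ g z := by
      have := hy.2
      rwa [hin, inv_mul_le_iff₀ hc, mul_one] at this
    -- Separation covers positive bundles only. Mixing in `z` makes `y` positive, and the weight `s
    -- / 2` instead of `s` makes the mixture cost strictly less than `z`.
    have hcont : ContinuousWithinAt (fun s : ℝ => U ((1 - s) • y + (s / 2) • z)) (Set.Ioo 0 1)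
        0 := by
      have h1 : ContinuousWithinAt (fun s : ℝ => (1 - s) • y + (s / 2) • z) (Set.Ioo 0 1) 0 := by
        fun_prop
      refine ContinuousWithinAt.comp (t := consumptionSet L) ?_ h1 fun s hs l => ?_
      · simpa using hU.continuousOn y hy.1
      · have h2 := mul_nonneg (show 0 ≤ 1 - s by linarith [hs.2]) (hy.1 l)
        have h3 := mul_nonneg (show 0 ≤ s / 2 by linarith [hs.1]) (hz l).le
        simpa using add_nonneg h2 h3
    have hev := hcont.eventually (lt_mem_nhds (by simpa using hlt))
    have hne : (𝓝[Set.Ioo (0 : ℝ) 1] 0).NeBot := by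
      rw [← mem_closure_iff_nhdsWithin_neBot, closure_Ioo (by norm_num)]
      simp
    obtain ⟨s, hs, hs0, hs1⟩ := (hev.and self_mem_nhdsWithin).exists
    have h1 := hsep _ (fun l => by
      have h2 := mul_nonneg (show 0 ≤ 1 - s by linarith) (hy.1 l)
      have h3 := mul_pos (show 0 < s / 2 by linarith) (hz l)
      simpa using add_pos_of_nonneg_of_pos h2 h3) hs
    rw [inner_add_right, inner_smul_right, inner_smul_right] at h1
    nlinarith

/-- Observed pairs of a dense sequence of prices and the demanded bundles approximate every pair of
a price and its demanded bundle. -/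
lemma exists_tendsto_observations (hU : IsRegularUtility U) {q z : Bundle L}
    (hq : q ∈ positivePrices L) (hz : IsDemanded U q z) {p x : ℕ → Bundle L}
    (hx : ∀ k, IsDemanded U (p k) (x k)) (hdense : positivePrices L ⊆ closure (Set.range p)) :
    ∃ k : ℕ → ℕ, Tendsto (fun n => p (k n)) atTop (𝓝 q) ∧
      Tendsto (fun n => x (k n)) atTop (𝓝 z) := by
  obtain ⟨u, hu, hlim⟩ := mem_closure_iff_seq_limit.1 (hdense hq)
  choose m hm using hu
  have hpm : Tendsto (fun n => p (m n)) atTop (𝓝 q) := by simpa only [hm] using hlim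
  have hhalf : (1 / 2 : ℝ) • q ∈ positivePrices L := fun l => by
    have := hq l
    simpa using this
  -- Prices near `q` exceed `q / 2`, so the choices eventually stay in one compact budget.
  have hbd : ∀ᶠ n in atTop, x (m n) ∈ budget ((1 / 2 : ℝ) • q) := by
    have hcoord : ∀ᶠ n in atTop, ∀ l, ((1 / 2 : ℝ) • q) l ≤ p (m n) l := by
      refine eventually_all.2 fun l => ?_
      have h1 : Tendsto (fun n => p (m n) l) atTop (𝓝 (q l)) :=
        ((continuous_apply l).tendsto q).comp hpm
      have h2 := hq l
      exact (h1.eventually (lt_mem_nhds (show ((1 / 2 : ℝ) • q) l < q l by simp; linarith))).mono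
        fun n hn => hn.le
    filter_upwards [hcoord] with n hn
    refine ⟨(hx _).mem.1, le_trans ?_ (hx (m n)).mem.2⟩
    rw [real_inner_comm, real_inner_comm (x (m n))]
    exact inner_le_inner (hx _).mem.1 hn
  obtain ⟨w, -, g, hg, hw⟩ := (isCompact_budget hhalf).isSeqCompact.subseq_of_frequently_in
    hbd.frequently
  have hpg := hpm.comp hg.tendsto_atTop
  have hwX : w ∈ consumptionSet L :=
    (isClosed_consumptionSet L).mem_of_tendsto hw (Eventually.of_forall fun n => (hx _).mem.1)
  have hcontU : ∀ {v : ℕ → Bundle L} {c : Bundle L}, (∀ n, v n ∈ consumptionSet L) →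
      c ∈ consumptionSet L → Tendsto v atTop (𝓝 c) → Tendsto (fun n => U (v n)) atTop (𝓝 (U c)) :=
    fun hv hc h => (hU.continuousOn _ hc).tendsto.comp
      (tendsto_nhdsWithin_iff.2 ⟨h, Eventually.of_forall hv⟩)
  have hwD : IsDemanded U q w := by
    refine ⟨⟨hwX, le_of_tendsto (hpg.inner hw) (Eventually.of_forall fun n => (hx _).mem.2)⟩,
      fun y hy => ?_⟩
    -- Dividing by `d n` makes `y` affordable at the approximating price; `d n` tends to 1.
    set d : ℕ → ℝ := fun n => max 1 (inner ℝ (p (m (g n))) y) with hd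
    have hd1 : ∀ n, 1 ≤ d n := fun n => le_max_left _ _
    have hdlim : Tendsto d atTop (𝓝 1) := by
      have h1 : Tendsto (fun n => inner ℝ (p (m (g n))) y) atTop (𝓝 (inner ℝ q y)) :=
        hpg.inner tendsto_const_nhds
      have := (tendsto_const_nhds (x := (1 : ℝ))).max h1
      rwa [max_eq_left hy.2] at this
    have hylim : Tendsto (fun n => (d n)⁻¹ • y) atTop (𝓝 y) := by
      simpa using (hdlim.inv₀ one_ne_zero).smul_const y
    have hyX : ∀ n, (d n)⁻¹ • y ∈ consumptionSet L := fun n l => by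
      have := mul_nonneg (inv_nonneg.2 (zero_le_one.trans (hd1 n))) (hy.1 l)
      simpa using this
    refine le_of_tendsto_of_tendsto' (hcontU hyX hy.1 hylim)
      (hcontU (fun n => (hx (m (g n))).mem.1) hwX hw) fun n => (hx _).le _ ⟨hyX n, ?_⟩
    rw [inner_smul_right, inv_mul_le_iff₀ (by linarith [hd1 n]), mul_one]
    exact le_max_right _ _
  rw [hz.unique hU hwD]
  exact ⟨m ∘ g, hpg, hw⟩

end Demand

/-! ### Utility comparison through the lower envelope of a set of prices. -/

section Comparison

variable {L : ℕ} {U : Bundle L → ℝ}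

/-- If the numbers `ψ j` and slopes `s j` satisfy the `ε`-approximate supergradient inequality
between neighbours and each drop of `v` is controlled by the defect in that inequality, then the
total drop of `v` over `n` steps of size `1 / n` is small. -/
lemma sub_le_of_approx_supergradient {n : ℕ} (hn : 0 < n) {C S ε : ℝ} (hC : 0 ≤ C)
    {v ψ s : ℕ → ℝ} (hs : ∀ j ≤ n, |s j| ≤ S)
    (hsuper : ∀ j < n, ψ (j + 1) - ε ≤ ψ j + s j / n)
    (hdrop : ∀ j < n, v j - v (j + 1) ≤ C * (ψ (j + 1) - s (j + 1) / n - ψ j + 2 * ε)) :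
    v 0 - v n ≤ C * (2 * S / n + 3 * (n * ε)) := by
  have hn' : (0 : ℝ) < n := by exact_mod_cast hn
  -- Combining `hdrop` with `hsuper` leaves only slope differences, which telescope, and `3 * ε` per
  -- step.
  have hind : ∀ k ≤ n, v 0 - v k ≤ C * ((s 0 - s k) / n + 3 * (k * ε)) := by
    intro k
    induction k with
    | zero => intro _; simp
    | succ k ih =>
      intro hk
      have h1 := ih (by omega)
      have h2 := hdrop k (by omega)
      have h3 := hsuper k (by omega)
      have h4 : C * (ψ (k + 1) - s (k + 1) / n - ψ k + 2 * ε) ≤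
          C * ((s k - s (k + 1)) / n + 3 * ε) := by
        refine mul_le_mul_of_nonneg_left ?_ hC
        rw [sub_div]
        linarith
      have h5 : C * ((s 0 - s k) / n + 3 * (k * ε)) + C * ((s k - s (k + 1)) / n + 3 * ε) =
          C * ((s 0 - s (k + 1)) / n + 3 * (((k + 1 : ℕ) : ℝ) * ε)) := by
        push_cast
        ring
      linarith
  refine (hind n le_rfl).trans (mul_le_mul_of_nonneg_left ?_ hC)
  have h1 := abs_le.1 (hs 0 (Nat.zero_le n))
  have h2 := abs_le.1 (hs n le_rfl)
  have : (s 0 - s n) / n ≤ 2 * S / n := div_le_div_of_nonneg_right (by linarith) hn'.le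
  linarith

/-- A set `P` of prices that contains the prices supporting bundles just below `a`, that is closed
under passing to prices supporting bundles cheaper than one at some price in `P`, and at which `b`
never costs less than one, can only exist if `b` is at least as good as `a`. -/
theorem utility_le_of_price_closure [NeZero L] (hU : IsRegularUtility U) {a b : Bundle L}
    (ha : a ∈ positivePrices L) (hb : b ∈ positivePrices L) {P : Set (Bundle L)}
    (hpos : P ⊆ positivePrices L)
    (hstep : ∀ p ∈ P, ∀ z ∈ positivePrices L, inner ℝ p z < 1 → ∀ p' ∈ positivePrices L,
      IsDemanded U p' z → p' ∈ P)
    (hstart : ∀ τ : ℝ, 0 < τ → τ < 1 → ∀ p' ∈ positivePrices L, IsDemanded U p' (τ • a) → p' ∈ P)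
    (hend : ∀ p ∈ P, 1 ≤ inner ℝ p b) : U a ≤ U b := by
  have hX := positivePrices_subset_consumptionSet L
  have hsmul : ∀ {c : ℝ} {w : Bundle L}, 0 < c → w ∈ positivePrices L →
      c • w ∈ positivePrices L := fun hc hw l => by simpa using mul_pos hc (hw l)
  -- bounds for the coordinates
  obtain ⟨lo, hi, hlo, hlohi, hab⟩ : ∃ lo hi : ℝ, 0 < lo ∧ lo ≤ hi ∧
      ∀ l, (lo ≤ a l ∧ a l ≤ hi) ∧ (lo ≤ b l ∧ b l ≤ hi) := by
    obtain ⟨i, hi⟩ := Finite.exists_min fun l => min (a l) (b l)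
    obtain ⟨k, hk⟩ := Finite.exists_max fun l => max (a l) (b l)
    have h1 : ∀ l, _ := fun l => le_min_iff.1 (hi l)
    have h2 : ∀ l, _ := fun l => max_le_iff.1 (hk l)
    exact ⟨_, _, lt_min (ha i) (hb i), (h1 0).1.trans (h2 0).1,
      fun l => ⟨⟨(h1 l).1, (h2 l).1⟩, (h1 l).2, (h2 l).2⟩⟩
  have hhi : 0 < hi := hlo.trans_le hlohi
  have hratio : 1 ≤ hi / lo := (one_le_div hlo).2 hlohi
  set B : Set (Bundle L) := {w | ∀ l, lo ≤ w l ∧ w l ≤ hi} with hB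
  have hBpos : B ⊆ positivePrices L := fun w hw l => hlo.trans_le (hw l).1
  have hcompare : ∀ p ∈ positivePrices L, ∀ w ∈ B, ∀ w' ∈ B,
      inner ℝ p w ≤ hi / lo * inner ℝ p w' := by
    intro p hp w hw w' hw'
    rw [← inner_smul_right]
    refine inner_le_inner (hX hp) fun l => ?_
    have h1 : hi / lo * lo ≤ hi / lo * w' l :=
      mul_le_mul_of_nonneg_left (hw' l).1 (by positivity)
    rw [div_mul_cancel₀ _ hlo.ne'] at h1
    simpa using (hw l).2.trans h1
  have haB : a ∈ B := fun l => (hab l).1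
  have hbB : b ∈ B := fun l => (hab l).2
  -- `2 * (hi / lo) + 1` will bound the near-minimal costs `ψ`; one more factor `hi / lo` bounds the
  -- cost of any bundle of `B` at the chosen prices.
  set M := hi / lo * (2 * (hi / lo) + 1) with hM
  have hM1 : 1 ≤ M := by
    rw [hM]
    nlinarith
  have hM2 : 2 * (hi / lo) + 1 ≤ M := by
    rw [hM]
    nlinarith
  have hlow : ∀ p ∈ P, ∀ w ∈ B, lo / hi ≤ inner ℝ p w := by
    intro p hp w hw
    have h1 := (hend p hp).trans (hcompare p (hpos hp) b hbB w hw)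
    rw [div_mul_eq_mul_div, one_le_div hlo] at h1
    rw [div_le_iff₀ hhi]
    linarith
  obtain ⟨p₀, hp₀, hp₀a⟩ : ∃ p ∈ P, inner ℝ p a = 2 := by
    obtain ⟨p, hp, hd⟩ := exists_supporting_price hU (hsmul (by norm_num : (0 : ℝ) < 1 / 2) ha)
    refine ⟨p, hstart _ (by norm_num) (by norm_num) p hp hd, ?_⟩
    have := hd.inner_eq_one hU hp
    rw [inner_smul_right] at this
    linarith
  -- near-minimal costs and the prices supporting the correspondingly scaled bundles
  have hnear : ∀ ε : ℝ, 0 < ε → ε ≤ 1 → ∀ w ∈ B, ∃ (ψ : ℝ) (π : Bundle L), lo / hi ≤ ψ ∧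
      ψ ≤ 2 * (hi / lo) + 1 ∧ π ∈ P ∧ inner ℝ π w = ψ ∧ IsDemanded U π (ψ⁻¹ • w) ∧
      ∀ p ∈ P, ψ - ε ≤ inner ℝ p w := by
    intro ε hε hε1 w hw
    set T := (fun p : Bundle L => inner ℝ p w) '' P with hT
    have hne : T.Nonempty := ⟨_, p₀, hp₀, rfl⟩
    have hbelow : lo / hi ∈ lowerBounds T := by
      rintro _ ⟨p, hp, rfl⟩
      exact hlow p hp w hw
    have hle : ∀ p ∈ P, sInf T ≤ inner ℝ p w := fun p hp => csInf_le ⟨_, hbelow⟩ ⟨p, hp, rfl⟩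
    have hge : lo / hi ≤ sInf T := le_csInf hne hbelow
    have hψ : 0 < sInf T + ε := by
      have : 0 < lo / hi := by positivity
      linarith
    have hzpos := hsmul (inv_pos.2 hψ) (hBpos hw)
    obtain ⟨_, ⟨p, hp, rfl⟩, hlt⟩ := exists_lt_of_csInf_lt hne (lt_add_of_pos_right (sInf T) hε)
    obtain ⟨π, hπ, hd⟩ := exists_supporting_price hU hzpos
    -- Adding `ε` to the infimum makes the scaled bundle cost strictly less than 1 at some price of
    -- `P`, as `hstep` requires.
    have hπP : π ∈ P := by
      refine hstep p hp _ hzpos ?_ π hπ hd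
      rw [inner_smul_right, inv_mul_lt_iff₀ hψ, mul_one]
      exact hlt
    refine ⟨sInf T + ε, π, by linarith, ?_, hπP, ?_, hd, fun p hp => by linarith [hle p hp]⟩
    · have h1 := hle p₀ hp₀
      have h2 := hcompare p₀ (hpos hp₀) w hw a haB
      rw [hp₀a] at h2
      linarith
    · have := hd.inner_eq_one hU hπ
      rwa [inner_smul_right, inv_mul_eq_one₀ hψ.ne', eq_comm] at this
  -- the Lipschitz estimate along rays
  obtain ⟨C, hC, hLip⟩ : ∃ C : ℝ, 0 ≤ C ∧ ∀ w ∈ B, ∀ c d : ℝ, lo / hi ≤ c → c ≤ M → lo / hi ≤ d →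
      d ≤ M → |U (c⁻¹ • w) - U (d⁻¹ • w)| ≤ C * |c - d| := by
    -- Large enough for the box to contain coordinates from `lo / M` up to `hi * (hi / lo)`.
    set r := M / lo + hi * (hi / lo) with hr
    obtain ⟨K, hK, hKU⟩ := hU.lipschitz r (by positivity)
    have hbox : ∀ w ∈ B, ∀ c : ℝ, lo / hi ≤ c → c ≤ M → c⁻¹ • w ∈ interiorBox L r := by
      intro w hw c hc1 hc2
      have hc : 0 < c := lt_of_lt_of_le (by positivity) hc1
      refine ⟨hX (hsmul (inv_pos.2 hc) (hBpos hw)), fun l => ⟨?_, ?_⟩⟩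
      · have h1 : M⁻¹ * lo ≤ c⁻¹ * w l := by
          have := (hw l).1
          gcongr
        have h2 : 1 / (1 + r) ≤ M⁻¹ * lo := by
          rw [show M⁻¹ * lo = 1 / (M / lo) by field_simp]
          refine one_div_le_one_div_of_le (by positivity) ?_
          have : 0 < hi * (hi / lo) := by positivity
          rw [hr]
          linarith
        simpa using h2.trans h1
      · have h1 : c⁻¹ * w l ≤ (lo / hi)⁻¹ * hi := by
          have := (hw l).2
          have := (hBpos hw l).le
          gcongr
        have h2 : (lo / hi)⁻¹ * hi ≤ 1 + r := by
          have : 0 < M / lo := by positivity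
          rw [inv_div, hr]
          linarith
        simpa using h1.trans h2
    refine ⟨K * ((hi / lo) ^ 2 * ∑ _l : Fin L, hi), by positivity,
      fun w hw c d hc1 hc2 hd1 hd2 => ?_⟩
    have hc : 0 < c := lt_of_lt_of_le (by positivity) hc1
    have hd : 0 < d := lt_of_lt_of_le (by positivity) hd1
    refine (hKU _ (hbox w hw c hc1 hc2) _ (hbox w hw d hd1 hd2)).trans ?_
    rw [mul_assoc K]
    refine mul_le_mul_of_nonneg_left ?_ hK.le
    rw [← sub_smul, norm_smul, Real.norm_eq_abs, inv_sub_inv hc.ne' hd.ne', abs_div,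
      abs_sub_comm d c, abs_of_pos (mul_pos hc hd)]
    have h1 : ‖w‖ ≤ ∑ _l : Fin L, hi := by
      refine (norm_le_sum_abs w).trans (Finset.sum_le_sum fun l _ => ?_)
      rw [abs_of_pos (hBpos hw l)]
      exact (hw l).2
    have h2 : |c - d| / (c * d) ≤ (hi / lo) ^ 2 * |c - d| := by
      rw [div_eq_inv_mul]
      refine mul_le_mul_of_nonneg_right ?_ (abs_nonneg _)
      calc (c * d)⁻¹ ≤ (lo / hi * (lo / hi))⁻¹ := by gcongr
        _ = (hi / lo) ^ 2 := by rw [mul_inv, inv_div, sq]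
    calc |c - d| / (c * d) * ‖w‖ ≤ ((hi / lo) ^ 2 * |c - d|) * ∑ _l : Fin L, hi := by gcongr
      _ = (hi / lo) ^ 2 * (∑ _l : Fin L, hi) * |c - d| := by ring
  -- the estimate for a partition of the segment from `a` to `b` into `n` steps
  have hbound : ∀ n : ℕ, 0 < n → U a - U b ≤ C * (2 * M + 4) / n := by
    intro n hn
    have hn' : (1 : ℝ) ≤ n := by exact_mod_cast hn
    have hn0 : (0 : ℝ) < n := by linarith
    -- The error accumulated over `n` steps is then only `1 / n`.
    set ε : ℝ := 1 / (n : ℝ) ^ 2 with hε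
    have hε0 : 0 < ε := by positivity
    have hεn : n * ε = 1 / n := by
      rw [hε]
      field_simp
    have hε1 : ε ≤ 1 / n := by
      rw [← hεn]
      exact le_mul_of_one_le_left hε0.le hn'
    have hε2 : ε ≤ 1 := hε1.trans ((div_le_one hn0).2 hn')
    choose! ψ π hψ1 hψ2 hπ hπψ hdem hsup using hnear ε hε0 hε2
    set m : ℕ → Bundle L := fun j => a + ((j : ℝ) / n) • (b - a) with hm
    have hmB : ∀ j ≤ n, m j ∈ B := by
      intro j hj l
      have h1 : (j : ℝ) / n ≤ 1 := (div_le_one hn0).2 (by exact_mod_cast hj)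
      have h2 : 0 ≤ (j : ℝ) / n := by positivity
      have hal := (hab l).1
      have hbl := (hab l).2
      have : m j l = a l + (j : ℝ) / n * (b l - a l) := by simp [hm]
      rw [this]
      constructor <;> nlinarith
    have hm0 : m 0 = a := by simp [hm]
    have hmn : m n = b := by simp [hm, div_self hn0.ne']
    have hmsucc : ∀ j, m (j + 1) = m j + (1 / n : ℝ) • (b - a) := by
      intro j
      simp only [hm, add_assoc, ← add_smul]
      push_cast
      rw [add_div]
    have hπle : ∀ w ∈ B, ∀ w' ∈ B, inner ℝ (π w) w' ≤ M := by
      intro w hw w' hw'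
      refine (hcompare _ (hpos (hπ w hw)) w' hw' w hw).trans ?_
      rw [hπψ w hw, hM]
      exact mul_le_mul_of_nonneg_left (hψ2 w hw) (by positivity)
    set s : ℕ → ℝ := fun j => inner ℝ (π (m j)) (b - a) with hs
    have hsbound : ∀ j ≤ n, |s j| ≤ M := by
      intro j hj
      have hP := hX (hpos (hπ _ (hmB j hj)))
      have h1 := hπle _ (hmB j hj) a haB
      have h2 := hπle _ (hmB j hj) b hbB
      have h3 := inner_nonneg hP (hX ha)
      have h4 := inner_nonneg hP (hX hb)
      simp only [hs, inner_sub_right]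
      exact abs_le.2 ⟨by linarith, by linarith⟩
    have hsuper : ∀ j < n, ψ (m (j + 1)) - ε ≤ ψ (m j) + s j / n := by
      intro j hj
      have h1 := hsup _ (hmB (j + 1) hj) _ (hπ _ (hmB j hj.le))
      rw [hmsucc, inner_add_right, inner_smul_right, hπψ _ (hmB j hj.le)] at h1
      rw [hmsucc]
      simpa [hs, div_eq_inv_mul] using h1
    -- Compare through `d⁻¹ • m j`, which is exactly affordable at the price supporting the next
    -- scaled bundle; what remains is a Lipschitz estimate along the ray through `m j`.
    have hdrop : ∀ j < n, U ((ψ (m j))⁻¹ • m j) - U ((ψ (m (j + 1)))⁻¹ • m (j + 1)) ≤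
        C * (ψ (m (j + 1)) - s (j + 1) / n - ψ (m j) + 2 * ε) := by
      intro j hj
      have hwj := hmB j hj.le
      have hwj' := hmB (j + 1) hj
      set d := inner ℝ (π (m (j + 1))) (m j) with hd
      have hdeq : ψ (m (j + 1)) - s (j + 1) / n = d := by
        have h1 := hπψ _ hwj'
        nth_rewrite 2 [hmsucc] at h1
        rw [inner_add_right, inner_smul_right] at h1
        rw [← h1, hd]
        simp only [hs]
        ring
      have hd1 : lo / hi ≤ d := hlow _ (hπ _ hwj') _ hwj
      have hd0 : 0 < d := lt_of_lt_of_le (by positivity) hd1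
      have h1 := hLip _ hwj (ψ (m j)) d (hψ1 _ hwj) ((hψ2 _ hwj).trans hM2) hd1
        (hπle _ hwj' _ hwj)
      have h2 : U (d⁻¹ • m j) ≤ U ((ψ (m (j + 1)))⁻¹ • m (j + 1)) := by
        refine (hdem _ hwj').le _ ⟨hX (hsmul (inv_pos.2 hd0) (hBpos hwj)), ?_⟩
        rw [inner_smul_right, inv_mul_cancel₀ hd0.ne']
      have h3 : |ψ (m j) - d| ≤ d - ψ (m j) + 2 * ε := by
        have := hsup _ hwj _ (hπ _ hwj')
        exact abs_le.2 ⟨by linarith, by linarith⟩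
      rw [hdeq]
      have h4 := mul_le_mul_of_nonneg_left h3 hC
      linarith [le_abs_self (U ((ψ (m j))⁻¹ • m j) - U (d⁻¹ • m j))]
    have hmain := sub_le_of_approx_supergradient hn hC
      (v := fun j => U ((ψ (m j))⁻¹ • m j)) (ψ := fun j => ψ (m j)) hsbound hsuper hdrop
    simp only [hm0, hmn, hεn] at hmain
    have hfirst : U a - U ((ψ a)⁻¹ • a) ≤ C * ε := by
      -- Prices supporting `(1 + δ / 2)⁻¹ • a` lie in `P` and value `a` at `1 + δ / 2`.
      have hψa : ψ a ≤ 1 + ε := by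
        refine le_of_forall_pos_lt_add fun δ hδ => ?_
        have hδ1 : 0 < 1 + δ / 2 := by positivity
        obtain ⟨p, hp, hd⟩ := exists_supporting_price hU (hsmul (inv_pos.2 hδ1) ha)
        have h1 := hsup a haB p (hstart _ (inv_pos.2 hδ1)
          (inv_lt_one_of_one_lt₀ (by linarith)) p hp hd)
        have h2 := hd.inner_eq_one hU hp
        rw [inner_smul_right, inv_mul_eq_one₀ hδ1.ne'] at h2
        linarith
      have hψ0 : 0 < ψ a := lt_of_lt_of_le (by positivity) (hψ1 a haB)
      have h1 : U ((1 + ε)⁻¹ • a) ≤ U ((ψ a)⁻¹ • a) := by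
        refine hU.monotone (hX (hsmul (by positivity) ha)) (hX (hsmul (by positivity) ha))
          fun l => ?_
        have := (ha l).le
        simp only [PiLp.smul_apply, smul_eq_mul]
        gcongr
      have hlh : lo / hi ≤ 1 := (div_le_one hhi).2 hlohi
      have h2 := hLip a haB 1 (1 + ε) hlh hM1 (by linarith) (by linarith)
      rw [inv_one, one_smul, show (1 : ℝ) - (1 + ε) = -ε by ring, abs_neg, abs_of_pos hε0] at h2
      linarith [le_abs_self (U a - U ((1 + ε)⁻¹ • a))]
    have hlast : U ((ψ b)⁻¹ • b) ≤ U b := by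
      have h1 : 1 ≤ ψ b := by
        rw [← hπψ b hbB]
        exact hend _ (hπ b hbB)
      refine hU.monotone (hX (hsmul (by positivity) hb)) (hX hb) fun l => ?_
      have := mul_le_of_le_one_left (hb l).le (inv_le_one_of_one_le₀ h1)
      simpa using this
    have h5 : C * ε ≤ C * (1 / n) := mul_le_mul_of_nonneg_left hε1 hC
    have h6 : C * (2 * M / n + 3 * (1 / n)) + C * (1 / n) = C * (2 * M + 4) / n := by
      field_simp
      ring
    linarith
  by_contra! hlt
  obtain ⟨n, hn⟩ := exists_nat_gt (C * (2 * M + 4) / (U a - U b))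
  have hn0 : (0 : ℝ) < n := lt_of_le_of_lt
    (div_nonneg (mul_nonneg hC (by linarith)) (by linarith)) hn
  have h1 := hbound n (by exact_mod_cast hn0)
  rw [div_lt_iff₀ (by linarith)] at hn
  rw [le_div_iff₀ hn0] at h1
  linarith
end Comparison

/-! ### Chains of observations and the revealing of strict preference. -/

section Chains

variable {L : ℕ} {p x : ℕ → Bundle L} {a b : Bundle L}

/-- The observation `m` ends a chain of strict cost comparisons that starts at a choice bounded
above by `a`. -/
def ReachableObservation (p x : ℕ → Bundle L) (a : Bundle L) (m : ℕ) : Prop :=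
  ∃ (k : ℕ) (i : ℕ → ℕ), (∀ l, x (i 0) l ≤ a l) ∧
    (∀ j < k, inner ℝ (p (i j)) (x (i (j + 1))) < inner ℝ (p (i j)) (x (i j))) ∧ i k = m

lemma reachableObservation_of_le {m : ℕ} (h : ∀ l, x m l ≤ a l) : ReachableObservation p x a m :=
  ⟨0, fun _ => m, h, fun j hj => absurd hj (Nat.not_lt_zero j), rfl⟩

/-- Reachability allows an empty chain, whereas revealed preference needs a strict comparison;
appending `m'` guarantees `1 ≤ k`. -/
lemma ReachableObservation.exists_chain {m m' : ℕ} (h : ReachableObservation p x a m)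
    (hlt : inner ℝ (p m) (x m') < inner ℝ (p m) (x m)) :
    ∃ (k : ℕ) (i : ℕ → ℕ), 1 ≤ k ∧ (∀ l, x (i 0) l ≤ a l) ∧
      (∀ j < k, inner ℝ (p (i j)) (x (i (j + 1))) < inner ℝ (p (i j)) (x (i j))) ∧ i k = m' := by
  obtain ⟨k, i, h0, hi, rfl⟩ := h
  refine ⟨k + 1, fun j => if j ≤ k then i j else m', by omega, by simpa using h0, fun j hj => ?_,
    by simp⟩
  rcases Nat.lt_or_ge j k with hjk | hjk
  · simpa [hjk.le, Nat.succ_le_of_lt hjk] using hi j hjk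
  · obtain rfl : j = k := by omega
    simpa using hlt

lemma ReachableObservation.step {m m' : ℕ} (h : ReachableObservation p x a m)
    (hlt : inner ℝ (p m) (x m') < inner ℝ (p m) (x m)) : ReachableObservation p x a m' := by
  obtain ⟨k, i, -, h0, hi, hk⟩ := h.exists_chain hlt
  exact ⟨k, i, h0, hi, hk⟩

lemma ReachableObservation.exists_revealedPreferred {m m' : ℕ}
    (h : ReachableObservation p x a m) (hlt : inner ℝ (p m) (x m') < inner ℝ (p m) (x m))
    (hb : ∀ l, b l ≤ x m' l) : ∃ n, RevealedPreferred p x n a b := by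
  obtain ⟨k, i, hk, h0, hi, rfl⟩ := h.exists_chain hlt
  exact ⟨(Finset.range (k + 1)).sup i + 1, k, i, hk,
    fun j hj => Nat.lt_succ_of_le (Finset.le_sup (Finset.mem_range.2 (by omega))), h0, hi, hb⟩

lemma RevealedPreferred.mono {n n' : ℕ} {b' : Bundle L} (h : RevealedPreferred p x n a b)
    (hn : n ≤ n') (hb : ∀ l, b' l ≤ b l) : RevealedPreferred p x n' a b' := by
  obtain ⟨k, i, hk, hi, h0, hlt, hle⟩ := h
  exact ⟨k, i, hk, fun j hj => (hi j hj).trans_le hn, h0, hlt, fun l => (hb l).trans (hle l)⟩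

lemma eventually_forall_apply_lt {v : ℕ → Bundle L} {y z : Bundle L}
    (hv : Tendsto v atTop (𝓝 y)) (h : ∀ l, y l < z l) : ∀ᶠ n in atTop, ∀ l, v n l < z l :=
  eventually_all.2 fun l =>
    (((continuous_apply l).tendsto y).comp hv).eventually (gt_mem_nhds (h l))

lemma eventually_forall_lt_apply {v : ℕ → Bundle L} {y z : Bundle L}
    (hv : Tendsto v atTop (𝓝 y)) (h : ∀ l, z l < y l) : ∀ᶠ n in atTop, ∀ l, z l < v n l :=
  eventually_all.2 fun l =>
    (((continuous_apply l).tendsto y).comp hv).eventually (lt_mem_nhds (h l))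

lemma exists_inner_add_smul_ones_lt_one {q y : Bundle L} (hq : inner ℝ q y < 1) :
    ∃ δ : ℝ, 0 < δ ∧ inner ℝ q (y + δ • ones L) < 1 := by
  have hc : Continuous fun δ : ℝ => inner ℝ q (y + δ • ones L) := by fun_prop
  have hev : ∀ᶠ δ in 𝓝[>] (0 : ℝ), inner ℝ q (y + δ • ones L) < 1 :=
    (hc.tendsto 0).mono_left nhdsWithin_le_nhds |>.eventually (gt_mem_nhds (by simpa using hq))
  obtain ⟨δ, h1, h2⟩ := (hev.and self_mem_nhdsWithin).exists
  exact ⟨δ, h2, h1⟩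

/-- Strict preference between bundles with positive coordinates is eventually revealed by the
choices at a dense sequence of prices. -/
theorem exists_revealedPreferred [NeZero L] {U : Bundle L → ℝ} (hU : IsRegularUtility U)
    (hp : ∀ k, p k ∈ positivePrices L) (hx : ∀ k, IsDemanded U (p k) (x k))
    (hdense : positivePrices L ⊆ closure (Set.range p)) (ha : a ∈ positivePrices L)
    (hb : b ∈ positivePrices L) (hab : U b < U a) : ∃ n, RevealedPreferred p x n a b := by
  by_contra hno
  -- Stating membership through cheap bundles makes `P` contain unobserved prices, which are reached
  -- only as limits of observations.
  refine absurd (utility_le_of_price_closure hU ha hb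
    (P := {q | q ∈ positivePrices L ∧ ∀ y : Bundle L, inner ℝ q y < 1 →
      ∃ m, ReachableObservation p x a m ∧ inner ℝ (p m) y < 1}) (fun q hq => hq.1) ?_ ?_ ?_)
    (not_le.2 hab)
  · intro q hq z hz hqz q' hq' hd
    refine ⟨hq', fun y hy => ?_⟩
    obtain ⟨m, hm, hmz⟩ := hq.2 z hqz
    obtain ⟨k, hk1, hk2⟩ := exists_tendsto_observations hU hq' hd hx hdense
    have h1 : ∀ᶠ n in atTop, inner ℝ (p m) (x (k n)) < 1 :=
      (tendsto_const_nhds.inner hk2).eventually (gt_mem_nhds hmz)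
    have h2 : ∀ᶠ n in atTop, inner ℝ (p (k n)) y < 1 :=
      (hk1.inner tendsto_const_nhds).eventually (gt_mem_nhds hy)
    obtain ⟨n, hn1, hn2⟩ := (h1.and h2).exists
    refine ⟨k n, hm.step ?_, hn2⟩
    rwa [(hx m).inner_eq_one hU (hp m)]
  · intro τ hτ0 hτ1 q' hq' hd
    refine ⟨hq', fun y hy => ?_⟩
    obtain ⟨k, hk1, hk2⟩ := exists_tendsto_observations hU hq' hd hx hdense
    have h1 := eventually_forall_apply_lt hk2 (z := a) fun l => by
      simpa using mul_lt_of_lt_one_left (ha l) hτ1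
    have h2 : ∀ᶠ n in atTop, inner ℝ (p (k n)) y < 1 :=
      (hk1.inner tendsto_const_nhds).eventually (gt_mem_nhds hy)
    obtain ⟨n, hn1, hn2⟩ := (h1.and h2).exists
    exact ⟨k n, reachableObservation_of_le fun l => (hn1 l).le, hn2⟩
  -- If `b` cost less than 1, so would a slightly larger bundle; an observed choice near the latter
  -- dominates `b` and completes a forbidden chain.
  · intro q hq
    by_contra! hlt
    obtain ⟨m, hm, hmb⟩ := hq.2 b hlt
    obtain ⟨δ, hδ, hδb⟩ := exists_inner_add_smul_ones_lt_one hmb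
    have hpos : b + δ • ones L ∈ positivePrices L := fun l => by
      simpa using add_pos (hb l) hδ
    obtain ⟨q', hq', hd⟩ := exists_supporting_price hU hpos
    obtain ⟨k, -, hk2⟩ := exists_tendsto_observations hU hq' hd hx hdense
    have h1 := eventually_forall_lt_apply hk2 (z := b) fun l => by simpa using hδ
    have h2 : ∀ᶠ n in atTop, inner ℝ (p m) (x (k n)) < 1 :=
      (tendsto_const_nhds.inner hk2).eventually (gt_mem_nhds hδb)
    obtain ⟨n, hn1, hn2⟩ := (h1.and h2).exists
    refine hno (hm.exists_revealedPreferred (m' := k n) ?_ fun l => (hn1 l).le)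
    rwa [(hx m).inner_eq_one hU (hp m)]

/-- A bundle that is worse than an affordable bundle is, together with all nearby bundles,
eventually revealed to be worse than an affordable bundle. -/
lemma eventually_exists_revealedPreferred [NeZero L] {U : Bundle L → ℝ}
    (hU : IsRegularUtility U) (hp : ∀ k, p k ∈ positivePrices L)
    (hx : ∀ k, IsDemanded U (p k) (x k)) (hdense : positivePrices L ⊆ closure (Set.range p))
    {q z y : Bundle L} (hq : q ∈ positivePrices L) (hz : z ∈ budget q)
    (hy : y ∈ consumptionSet L) (hyz : U y < U z) :
    ∃ N, ∀ᶠ y' in 𝓝 y, ∀ n ≥ N, ∃ a ∈ budget q, RevealedPreferred p x n a y' := by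
  -- The core result needs positive bundles: `z` is moved slightly towards an affordable multiple of
  -- `ones L`.
  obtain ⟨a, ha, haq, hya⟩ : ∃ a ∈ positivePrices L, inner ℝ q a ≤ 1 ∧ U y < U a := by
    have hc := inner_pos hq (ones_mem L)
    set w := (inner ℝ q (ones L))⁻¹ • ones L with hw
    have hwpos : ∀ l, 0 < w l := fun l => by simpa [hw] using hc
    have hqw : inner ℝ q w = 1 := by rw [hw, inner_smul_right, inv_mul_cancel₀ hc.ne']
    have hcont : ContinuousWithinAt (fun s : ℝ => U ((1 - s) • z + s • w)) (Set.Ioo 0 1) 0 := by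
      have h1 : ContinuousWithinAt (fun s : ℝ => (1 - s) • z + s • w) (Set.Ioo 0 1) 0 := by
        fun_prop
      refine ContinuousWithinAt.comp (t := consumptionSet L) ?_ h1 fun s hs =>
        convex_consumptionSet L hz.1 (positivePrices_subset_consumptionSet L hwpos)
          (by linarith [hs.2]) hs.1.le (by ring)
      simpa using hU.continuousOn z hz.1
    have hev := hcont.eventually (lt_mem_nhds (by simpa using hyz))
    have hne : (𝓝[Set.Ioo (0 : ℝ) 1] 0).NeBot := by
      rw [← mem_closure_iff_nhdsWithin_neBot, closure_Ioo (by norm_num)]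
      simp
    obtain ⟨s, hs, hs0, hs1⟩ := (hev.and self_mem_nhdsWithin).exists
    refine ⟨(1 - s) • z + s • w, fun l => ?_, ?_, hs⟩
    · have h2 := mul_nonneg (show 0 ≤ 1 - s by linarith) (hz.1 l)
      have h3 := mul_pos hs0 (hwpos l)
      simpa using add_pos_of_nonneg_of_pos h2 h3
    · rw [inner_add_right, inner_smul_right, inner_smul_right, hqw]
      nlinarith [hz.2]
  -- Raising `y` by `δ` in each coordinate makes it positive and dominates every bundle within `δ`
  -- of `y`.
  obtain ⟨δ, hδ, hδa⟩ : ∃ δ : ℝ, 0 < δ ∧ U (y + δ • ones L) < U a := by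
    have hcont : ContinuousWithinAt (fun δ : ℝ => U (y + δ • ones L)) (Set.Ioi 0) 0 := by
      have h1 : ContinuousWithinAt (fun δ : ℝ => y + δ • ones L) (Set.Ioi 0) 0 := by fun_prop
      refine ContinuousWithinAt.comp (t := consumptionSet L) ?_ h1 fun δ hδ l => ?_
      · simpa using hU.continuousOn y hy
      · simpa using add_nonneg (hy l) (Set.mem_Ioi.1 hδ).le
    obtain ⟨δ, h1, h2⟩ := ((hcont.eventually (gt_mem_nhds (by simpa using hya))).and
      self_mem_nhdsWithin).exists
    exact ⟨δ, h2, h1⟩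
  obtain ⟨N, hN⟩ := exists_revealedPreferred hU hp hx hdense ha
    (b := y + δ • ones L) (fun l => by simpa using add_pos_of_nonneg_of_pos (hy l) hδ) hδa
  refine ⟨N, ?_⟩
  filter_upwards [Metric.ball_mem_nhds y hδ] with y' hy' n hn
  refine ⟨a, ⟨positivePrices_subset_consumptionSet L ha, haq⟩, hN.mono hn fun l => ?_⟩
  have h1 := (le_abs_self _).trans (abs_apply_le_norm (y' - y) l)
  rw [Metric.mem_ball, dist_eq_norm] at hy'
  simp only [PiLp.sub_apply] at h1
  simp only [PiLp.add_apply, PiLp.smul_apply, ones_apply, smul_eq_mul, mul_one]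
  linarith

end Chains

end RevealedDemand

/-! ### The convergence theorem, by compactness. -/

open RevealedDemand

theorem theorem2 (L : ℕ)
    (R : RevealedDemand.Bundle L → RevealedDemand.Bundle L → Prop)
    (hpref : RevealedDemand.IsPreference R)
    (hcont : RevealedDemand.IsContinuousPref R)
    (hconv : RevealedDemand.IsStrictlyConvexPref R)
    (hmono : RevealedDemand.IsMonotonePref R)
    (hlip : RevealedDemand.IsLipschitzianPref R)
    (p : ℕ → RevealedDemand.Bundle L)
    (hp : ∀ k, p k ∈ RevealedDemand.positivePrices L)
    (hdense : RevealedDemand.positivePrices L ⊆ closure (Set.range p)) :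
    ∃ f : RevealedDemand.Bundle L → RevealedDemand.Bundle L,
      (∀ q ∈ RevealedDemand.positivePrices L, RevealedDemand.demand R q = {f q}) ∧
      ∀ q ∈ RevealedDemand.positivePrices L, ∀ ε : ℝ, 0 < ε →
        ∃ N : ℕ, ∀ n ≥ N,
          RevealedDemand.revealedDemand p (fun k => f (p k)) n q ⊆
            {x | x ∈ RevealedDemand.budget q ∧ ‖f q - x‖ ≤ ε} := by
  -- With no commodities every cost is 0, so no bundle costs 1 and revealed demand is empty.
  rcases Nat.eq_zero_or_pos L with rfl | hL
  · refine ⟨fun _ => 0, fun q _ => ?_, fun q _ ε _ => ⟨0, fun n _ y hy => ?_⟩⟩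
    · have h0 : (0 : Bundle 0) ∈ consumptionSet 0 := fun l => l.elim0
      refine Set.eq_singleton_iff_unique_mem.2 ⟨⟨⟨h0, by simp⟩, fun y _ => ?_⟩,
        fun y _ => Subsingleton.elim _ _⟩
      rw [Subsingleton.elim y 0]
      simpa using hpref.complete 0 h0 0 h0
    · have := hy.2.1
      rw [Subsingleton.elim y 0] at this
      simp at this
  · have : NeZero L := ⟨hL.ne'⟩
    obtain ⟨U, hU, hrep⟩ := exists_isRegularUtility hpref hcont hconv hmono hlip
    have hex : ∀ q ∈ positivePrices L, ∃ z, IsDemanded U q z := fun q hq => exists_isDemanded hU hq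
    choose! f hf using hex
    refine ⟨f, fun q hq => ?_, fun q hq ε hε => ?_⟩
    · ext y
      rw [mem_demand_iff hrep, Set.mem_singleton_iff]
      refine ⟨fun h => h.unique hU (hf q hq), ?_⟩
      rintro rfl
      exact hf q hq
    · have hx : ∀ k, IsDemanded U (p k) (f (p k)) := fun k => hf _ (hp k)
      have hK : IsCompact (budget q ∩ {y | ε ≤ ‖f q - y‖}) :=
        (isCompact_budget hq).inter_right (isClosed_le continuous_const (by fun_prop))
      obtain ⟨N, hN⟩ : ∃ N, ∀ y ∈ budget q ∩ {y | ε ≤ ‖f q - y‖}, ∀ n ≥ N, ∃ a ∈ budget q,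
          RevealedPreferred p (fun k => f (p k)) n a y := by
        -- Compact induction: the property passes to subsets and, via the maximum of the two
        -- thresholds, to unions, so local thresholds combine into one.
        refine hK.induction_on (p := fun s => ∃ N, ∀ y ∈ s, ∀ n ≥ N, ∃ a ∈ budget q,
          RevealedPreferred p (fun k => f (p k)) n a y) ⟨0, by simp⟩ ?_ ?_ ?_
        · rintro s t hst ⟨N, hN⟩
          exact ⟨N, fun y hy => hN y (hst hy)⟩
        · rintro s t ⟨N, hN⟩ ⟨N', hN'⟩
          exact ⟨max N N', fun y hy n hn => hy.elim
            (fun h => hN y h n ((le_max_left _ _).trans hn))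
            fun h => hN' y h n ((le_max_right _ _).trans hn)⟩
        · rintro y ⟨hy, hyε⟩
          have hne : y ≠ f q := by
            rintro rfl
            simp at hyε
            linarith
          have hlt : U y < U (f q) := by
            refine lt_of_le_of_ne ((hf q hq).le y hy) fun he => hne ?_
            exact IsDemanded.unique hU ⟨hy, fun w hw => he ▸ (hf q hq).le w hw⟩ (hf q hq)
          obtain ⟨N, hN⟩ := eventually_exists_revealedPreferred hU hp hx hdense hq (hf q hq).mem
            hy.1 hlt
          exact ⟨_, mem_nhdsWithin_of_mem_nhds hN, N, fun y' hy' => hy'⟩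
      refine ⟨N, fun n hn y hy => ?_⟩
      have hyB : y ∈ budget q := ⟨hy.1, hy.2.1.le⟩
      refine ⟨hyB, ?_⟩
      by_contra! hlt
      obtain ⟨a, ha, hrev⟩ := hN y ⟨hyB, hlt.le⟩ n hn
      exact hy.2.2 ⟨a, ha.1, ha.2, hrev⟩
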